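/- For positive coprime integers $p_0,q_0$ with $q_0\ge 3$, real $\theta,k$ and $\ell\in\mathbb Z$, put $a_n(\theta)=2\cos\bigl(2\pi(\tfrac{p_0}{q_0}n+\theta)\bigr)$ and let $A_{\theta,k,\ell}$ be the $q_0\times q_0$ matrix with diagonal entries $a_\ell,\dots,a_{\ell+q_0-1}$, entries $1$ at the positions directly above and below the diagonal, top right corner entry $e^{-ikq_0}$, bottom left corner entry $e^{ikq_0}$, and all other entries $0$. The discriminant $\Delta_{p_0/q_0}$ is the function of $E\in\mathbb C$, independent of $\theta$, $k$ and $\ell$, determined by Chambers' formula \[ \det(A_{\theta,k,\ell}-E)=\Delta_{p_0/q_0}(E)-2(-1)^{q_0}\bigl(\cos(2\pi q_0\theta)+\cos(kq_0)\bigr)\qquad(\theta,k\in\mathbb R,\ \ell\in\mathbb Z,\ E\in\mathbb C). \] For positive coprime integers $p,q$ with $q\ge 3$, put $b_n(\theta)=2\sin\bigl(2\pi(\tfrac{p}{q}n+\theta)\bigr)$ and let $B_{\theta,k}$ be the $q\times q$ matrix with zero diagonal, entries $b_{j}(\theta)$ at the positions $(j,j+1)$ and $(j+1,j)$ for $0\le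 j\le q-2$ (rows and columns are numbered from $0$ to $q-1$), top right corner entry $e^{-ikq}b_{q-1}(\theta)$, bottom left corner entry $e^{ikq}b_{q-1}(\theta)$, and all other entries $0$. Let $D_{\theta,k}(E)=\det(B_{\theta,k}-E)$, let $D^{(0)}_\theta(E)=D_{\theta,\pi/(2q)}(E)$ be its $k$-independent part, and let $\widetilde\Delta_{p/q}(E)=D^{(0)}_{0}(E)$ be the chiral discriminant. Lemma. Let $p,q$ be positive coprime integers. (i) If $q$ is odd and $q\ge 3$, then, with $p_0=2p$ and $q_0=q$, there is a function $\Delta_{p_0/q_0}$ satisfying Chambers' formula, and $\widetilde\Delta_{p/q}(E)=\Delta_{p_0/q_0}(E)$ for all $E\in\mathbb C$. (ii) If $q$ is even and $q/2\ge 3$, then, with $p_0=p$ and $q_0=q/2$, there is a function $\Delta_{p_0/q_0}$ satisfying Chambers' formula, and $\widetilde\Delta_{p/q}(E)=\Delta_{p_0/q_0}(E)^2$ for all $E\in\mathbb C$. -/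

import Mathlib

noncomputable section

/-- The chiral-gauge coefficient `b_n(θ) = 2 sin (2π ((p/q) n + θ))`. -/
def chiralCoeff (p q : ℕ) (θ : ℝ) (n : ℤ) : ℝ :=
  2 * Real.sin (2 * Real.pi * ((p : ℝ) / (q : ℝ) * (n : ℝ) + θ))

/-- The Harper potential `a_n(θ) = 2 cos (2π ((p₀/q₀) n + θ))`. -/
def harperCoeff (p₀ q₀ : ℕ) (θ : ℝ) (n : ℤ) : ℝ :=
  2 * Real.cos (2 * Real.pi * ((p₀ : ℝ) / (q₀ : ℝ) * (n : ℝ) + θ))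

/-- The `q × q` Floquet matrix `B_{θ,k,ℓ}` (for `q ≥ 3`) of the chiral-gauge operator, with rows and
columns numbered `0, …, q - 1`: zero diagonal, entry `b_{ℓ+i}` at positions `(i, i+1)` and `(i+1, i)`,
corner entries `e^{-ikq} b_{ℓ+q-1}` (top right) and `e^{ikq} b_{ℓ+q-1}` (bottom left). -/
def chiralMatrix (p q : ℕ) (θ k : ℝ) (ℓ : ℤ) : Matrix (Fin q) (Fin q) ℂ :=
  Matrix.of fun i j =>
    if (i : ℕ) + 1 = (j : ℕ) then (chiralCoeff p q θ (ℓ + ((i : ℕ) : ℤ)) : ℂ)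
    else if (j : ℕ) + 1 = (i : ℕ) then (chiralCoeff p q θ (ℓ + ((j : ℕ) : ℤ)) : ℂ)
    else if (i : ℕ) = 0 ∧ (j : ℕ) + 1 = q then
      Complex.exp (-(Complex.I * (k : ℂ) * (q : ℂ))) * (chiralCoeff p q θ (ℓ + (q : ℤ) - 1) : ℂ)
    else if (i : ℕ) + 1 = q ∧ (j : ℕ) = 0 then
      Complex.exp (Complex.I * (k : ℂ) * (q : ℂ)) * (chiralCoeff p q θ (ℓ + (q : ℤ) - 1) : ℂ)
    else 0

/-- The `q₀ × q₀` Floquet matrix `A_{θ,k,ℓ}` (for `q₀ ≥ 3`) of the critical almost Mathieu operator: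
diagonal `a_ℓ, …, a_{ℓ+q₀-1}`, ones next to the diagonal, and corner entries `e^{-ikq₀}` (top right)
and `e^{ikq₀}` (bottom left). -/
def harperMatrix (p₀ q₀ : ℕ) (θ k : ℝ) (ℓ : ℤ) : Matrix (Fin q₀) (Fin q₀) ℂ :=
  Matrix.of fun i j =>
    if i = j then (harperCoeff p₀ q₀ θ (ℓ + ((i : ℕ) : ℤ)) : ℂ)
    else if (i : ℕ) + 1 = (j : ℕ) then 1
    else if (j : ℕ) + 1 = (i : ℕ) then 1
    else if (i : ℕ) = 0 ∧ (j : ℕ) + 1 = q₀ then Complex.exp (-(Complex.I * (k : ℂ) * (q₀ : ℂ)))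
    else if (i : ℕ) + 1 = q₀ ∧ (j : ℕ) = 0 then Complex.exp (Complex.I * (k : ℂ) * (q₀ : ℂ))
    else 0

/-- `D_{θ,k}(E) = det (B_{θ,k,ℓ} - E)`, with `ℓ = 0`. -/
def chiralDet (p q : ℕ) (θ k : ℝ) (E : ℂ) : ℂ :=
  (chiralMatrix p q θ k 0 - E • (1 : Matrix (Fin q) (Fin q) ℂ)).det

/-- `D⁽⁰⁾_θ(E) = D_{θ, k = π/(2q)}(E)`, the part of `D_{θ,k}(E)` that does not depend on `k`
(the part depending on `k` is a multiple of `cos (kq)`). -/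
def chiralDetZero (p q : ℕ) (θ : ℝ) (E : ℂ) : ℂ :=
  chiralDet p q θ (Real.pi / (2 * (q : ℝ))) E

/-- The chiral discriminant `Δ̃_{p/q}(E) = D⁽⁰⁾_{θ=0}(E)`. -/
def chiralDiscriminant (p q : ℕ) (E : ℂ) : ℂ :=
  chiralDetZero p q 0 E

/-- Chambers' relation, which characterizes the discriminant `Δ` of the critical almost Mathieu
operator: `det (A_{θ,k,ℓ} - E) = Δ(E) - 2 (-1)^{q₀} (cos (2π q₀ θ) + cos (k q₀))` for all `θ, k, ℓ`
and `E`, where `Δ` depends neither on `θ` nor on `k` nor on `ℓ`. At most one `Δ` satisfies it. -/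
def IsChambersDiscriminant (p₀ q₀ : ℕ) (Δ : ℂ → ℂ) : Prop :=
  ∀ (θ k : ℝ) (ℓ : ℤ) (E : ℂ),
    (harperMatrix p₀ q₀ θ k ℓ - E • (1 : Matrix (Fin q₀) (Fin q₀) ℂ)).det =
      Δ E - 2 * (-1) ^ q₀ *
        ((Real.cos (2 * Real.pi * (q₀ : ℝ) * θ) + Real.cos (k * (q₀ : ℝ)) : ℝ) : ℂ)

/-- The discriminant `Δ_{p₀/q₀}(E)`: the value of `det (A_{θ,k,0} - E)` at `θ = 1/(4 q₀)` and
`k = π/(2 q₀)`, where both cosines in Chambers' relation vanish. -/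
def chambersDiscriminant (p₀ q₀ : ℕ) (E : ℂ) : ℂ :=
  (harperMatrix p₀ q₀ (1 / (4 * (q₀ : ℝ))) (Real.pi / (2 * (q₀ : ℝ))) 0
    - E • (1 : Matrix (Fin q₀) (Fin q₀) ℂ)).det

end

/-! Let `S` be the cyclic shift and `Z` the clock matrix with `ω = η ^ 2`. A diagonal gauge turns
the Harper matrix minus `E` into `x S + x⁻¹ Sᵀ + y Z + y⁻¹ Z⁻¹ - E`. Conjugation by `S` or `Z`
rotates the coefficients by `ω`, so of the degree-`q` monomials only the balanced ones, which lose
`x` and `y`, and four pure powers survive: this is Chambers' formula (`exists_det_weylPencil_eq`),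
up to its constant term `T`.

To find `T`, conjugate by a Gaussian circulant, which fixes `S` and sends `Z` to a multiple of `Z S`
(`det_weylPencil_eq_det_chiral`). For suitable `x`, `y` the pure powers cancel and the bonds become
`1 - ω ^ i`, which vanishes at `i = 0`. The ring is cut open, and `T` is the tridiagonal determinant
`cutDet`.

The chiral matrix at `θ = 0` is cut in the same way because `b_0 = 0`. A tridiagonal determinant
sees only products of opposite entries, and `b_n ^ 2 = (1 - ω ^ n) (1 - ω⁻¹ ^ n)` for `ω = exp (2πi
· 2p/q)`. For odd `q` this is `cutDet`; for even `q` also `b_{q/2} = 0`, and the determinant splits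
into two equal factors. -/

/-! ### Determinants of linear pencils as polynomials -/

/-- The determinant of the linear matrix pencil `∑ s, X s • N s`, as a polynomial. -/
noncomputable def pencilDet {σ n : Type*} [Fintype σ] [Fintype n] [DecidableEq n]
    (N : σ → Matrix n n ℂ) : MvPolynomial σ ℂ :=
  (Matrix.of fun i j => ∑ s, MvPolynomial.C (N s i j) * MvPolynomial.X s).det

theorem eval_pencilDet {σ n : Type*} [Fintype σ] [Fintype n] [DecidableEq n]
    (N : σ → Matrix n n ℂ) (v : σ → ℂ) :
    MvPolynomial.eval v (pencilDet N) = (∑ s, v s • N s).det := by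
  rw [pencilDet, RingHom.map_det]
  congr 1
  ext i j
  simp [Matrix.sum_apply, mul_comm]

theorem isHomogeneous_pencilDet {σ n : Type*} [Fintype σ] [Fintype n] [DecidableEq n]
    (N : σ → Matrix n n ℂ) : (pencilDet N).IsHomogeneous (Fintype.card n) := by
  rw [pencilDet, Matrix.det_apply']
  refine MvPolynomial.IsHomogeneous.sum _ _ _ fun τ _ => ?_
  have h : (∏ i, (Matrix.of fun i j => ∑ s, MvPolynomial.C (N s i j) * MvPolynomial.X s) (τ i) i :
      MvPolynomial σ ℂ).IsHomogeneous (∑ _i : n, 1) :=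
    MvPolynomial.IsHomogeneous.prod _ _ _ fun i _ =>
      MvPolynomial.IsHomogeneous.sum _ _ _ fun s _ => by
        simpa using (MvPolynomial.isHomogeneous_C σ (N s (τ i) i)).mul
          (MvPolynomial.isHomogeneous_X ℂ s)
  have h2 := (MvPolynomial.isHomogeneous_C σ (((Equiv.Perm.sign τ : ℤˣ) : ℤ) : ℂ)).mul h
  simpa using h2

theorem MvPolynomial.coeff_aeval_C_mul_X {σ : Type*} [Fintype σ] (t : σ → ℂ)
    (P : MvPolynomial σ ℂ) (m : σ →₀ ℕ) :
    coeff m (aeval (fun s => C (t s) * X s) P) = (∏ s, t s ^ m s) * coeff m P := by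
  classical
  induction P using MvPolynomial.induction_on' with
  | monomial u a =>
    rw [aeval_monomial, Finsupp.prod_fintype _ _ (by simp)]
    simp only [mul_pow, Finset.prod_mul_distrib, ← map_pow, ← map_prod]
    have : (∏ s, X s ^ u s : MvPolynomial σ ℂ) = monomial u 1 := by
      rw [monomial_eq, Finsupp.prod_fintype _ _ (by simp)]; simp
    rw [this, algebraMap_eq, C_mul_monomial, C_mul_monomial, coeff_monomial, coeff_monomial]
    split_ifs with h
    · subst h; ring
    · simp
  | add p r hp hr => rw [map_add, coeff_add, hp, hr, coeff_add, mul_add]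

/-- A diagonal substitution multiplies each coefficient by a character of its exponent, so an
invariant polynomial contains only monomials on which that character is trivial. -/
theorem MvPolynomial.prod_pow_eq_one_of_eval_eq {σ : Type*} [Fintype σ] (t : σ → ℂ)
    (P : MvPolynomial σ ℂ) (h : ∀ v : σ → ℂ, eval (fun s => t s * v s) P = eval v P)
    {m : σ →₀ ℕ} (hm : coeff m P ≠ 0) : ∏ s, t s ^ m s = 1 := by
  have key : aeval (fun s => C (t s) * X s) P = P := by
    refine MvPolynomial.funext fun v => ?_
    rw [← h v, map_aeval]
    have hid : (eval v).comp (algebraMap ℂ (MvPolynomial σ ℂ)) = RingHom.id ℂ := by ext; simp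
    rw [hid]
    simp only [map_mul, eval_C, eval_X]
    rfl
  have := MvPolynomial.coeff_aeval_C_mul_X t P m
  rw [key] at this
  exact mul_right_cancel₀ hm (by rw [← this, one_mul])

theorem MvPolynomial.IsHomogeneous.coeff_single_eq_eval {σ : Type*} [Fintype σ] [DecidableEq σ]
    {P : MvPolynomial σ ℂ} {d : ℕ} (hP : P.IsHomogeneous d) (s : σ) :
    coeff (Finsupp.single s d) P = eval (Pi.single s 1) P := by
  rw [eval_eq']
  rw [Finset.sum_eq_single (Finsupp.single s d)]
  · rw [Finset.prod_eq_one, mul_one]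
    intro i _
    by_cases h : i = s
    · subst h; simp
    · simp [Ne.symm h]
  · intro m hm hne
    have hd := hP (mem_support_iff.1 hm)
    have : ∃ i, i ≠ s ∧ m i ≠ 0 := by
      by_contra! hcon
      apply hne
      have hs : m = Finsupp.single s (m s) := by
        ext i
        by_cases h : i = s
        · subst h; simp
        · simp [Ne.symm h, hcon i h]
      rw [hs] at hd
      simp [Finsupp.weight_single] at hd
      rw [hs, hd]
    obtain ⟨i, hi, hi'⟩ := this
    rw [Finset.prod_eq_zero (Finset.mem_univ i), mul_zero]
    simp [hi, hi']
  · intro h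
    simp [notMem_support_iff.1 h]

/-! ### Shift and clock matrices -/

theorem val_finRotate_cases {q : ℕ} (i : Fin q) :
    ((finRotate q i : ℕ) = i + 1 ∧ (i : ℕ) + 1 < q) ∨
      ((finRotate q i : ℕ) = 0 ∧ (i : ℕ) + 1 = q) := by
  cases q with
  | zero => exact i.elim0
  | succ n =>
    by_cases h : i = Fin.last n
    · subst h; right; simp
    · left
      refine ⟨coe_finRotate_of_ne_last h, ?_⟩
      have := Fin.val_lt_last h
      omega

theorem Function.Periodic.apply_val_finRotate {α : Type*} {q : ℕ} {g : ℤ → α}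
    (hg : Function.Periodic g (q : ℤ)) (i : Fin q) (m : ℤ) :
    g (((finRotate q i : ℕ) : ℤ) + m) = g ((i : ℕ) + 1 + m) := by
  rcases val_finRotate_cases i with ⟨h, _⟩ | ⟨h, h'⟩
  · rw [h]; push_cast; rfl
  · rw [h, ← hg]
    congr 1
    have : (((i : ℕ) + 1 : ℕ) : ℤ) = q := by rw [h']
    push_cast at this ⊢
    linarith

/-- The cyclic shift matrix, with ones at the positions `(i, i + 1)` modulo `q`. -/
noncomputable def cyclicShift (q : ℕ) : Matrix (Fin q) (Fin q) ℂ :=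
  (finRotate q).permMatrix ℂ

/-- The clock matrix `diag (1, ω, …, ω ^ (q - 1))`. -/
noncomputable def clockMatrix (q : ℕ) (ω : ℂ) : Matrix (Fin q) (Fin q) ℂ :=
  Matrix.diagonal fun i => ω ^ (i : ℕ)

theorem cyclicShift_apply {q : ℕ} (i j : Fin q) :
    cyclicShift q i j = if finRotate q i = j then 1 else 0 := by
  simp [cyclicShift, Equiv.Perm.permMatrix, PEquiv.toMatrix_apply, eq_comm]

theorem det_cyclicShift (q : ℕ) : (cyclicShift q).det = (-1) ^ (q - 1) := by
  simp [cyclicShift, Matrix.det_permutation, sign_finRotate]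

theorem pow_val_finRotate {q : ℕ} {ω : ℂ} (hω : ω ^ q = 1) (i : Fin q) :
    ω ^ (finRotate q i : ℕ) = ω * ω ^ (i : ℕ) := by
  rcases val_finRotate_cases i with ⟨h, _⟩ | ⟨h, h'⟩
  · rw [h, pow_succ']
  · rw [h, ← pow_succ', h', hω, pow_zero]

/-! ### Symmetries of the pencil and the shape of Chambers' formula -/

/-- The generators of the pencil `a S + b Sᵀ + c Z + d Z⁻¹ + e`, with `S` the cyclic shift and `Z` the
clock matrix. -/
noncomputable def weylPencil (q : ℕ) (ω : ℂ) : Fin 5 → Matrix (Fin q) (Fin q) ℂ :=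
  ![cyclicShift q, (cyclicShift q).transpose, clockMatrix q ω, clockMatrix q ω⁻¹, 1]

theorem sum_weylPencil (q : ℕ) (ω : ℂ) (v : Fin 5 → ℂ) :
    ∑ s, v s • weylPencil q ω s = v 0 • cyclicShift q + v 1 • (cyclicShift q).transpose +
      v 2 • clockMatrix q ω + v 3 • clockMatrix q ω⁻¹ + v 4 • 1 := by
  simp [Fin.sum_univ_five, weylPencil]

/-- Conjugation by the shift, realized as a cyclic relabelling of rows and columns. -/
theorem eval_weylPencil_clock_scale {q : ℕ} {ω : ℂ} (hω : ω ^ q = 1) (v : Fin 5 → ℂ) :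
    MvPolynomial.eval (fun s => (![1, 1, ω, ω⁻¹, 1] : Fin 5 → ℂ) s * v s)
      (pencilDet (weylPencil q ω)) = MvPolynomial.eval v (pencilDet (weylPencil q ω)) := by
  have hω' : ω⁻¹ ^ q = 1 := by rw [inv_pow, hω, inv_one]
  rw [eval_pencilDet, eval_pencilDet,
    ← Matrix.det_submatrix_equiv_self (finRotate q) (∑ s, v s • weylPencil q ω s)]
  congr 1
  rw [sum_weylPencil, sum_weylPencil]
  ext i j
  simp [cyclicShift_apply, clockMatrix, Matrix.diagonal_apply, pow_val_finRotate hω,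
    -inv_pow, -finRotate_apply, pow_val_finRotate hω', Matrix.one_apply]
  split_ifs <;> ring

theorem cyclicShift_mul_clockMatrix {q : ℕ} {ω : ℂ} (hω : ω ^ q = 1) :
    cyclicShift q * clockMatrix q ω = ω • (clockMatrix q ω * cyclicShift q) := by
  ext i j
  rw [clockMatrix, Matrix.mul_diagonal, Matrix.smul_apply, Matrix.diagonal_mul, cyclicShift_apply]
  split_ifs with h
  · rw [← h, pow_val_finRotate hω]; simp
  · simp

theorem transpose_cyclicShift_mul_clockMatrix {q : ℕ} {ω : ℂ} (hω : ω ^ q = 1) (h0 : ω ≠ 0) :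
    (cyclicShift q).transpose * clockMatrix q ω =
      ω⁻¹ • (clockMatrix q ω * (cyclicShift q).transpose) := by
  have h := congrArg Matrix.transpose (cyclicShift_mul_clockMatrix hω)
  rw [Matrix.transpose_smul, Matrix.transpose_mul, Matrix.transpose_mul,
    show (clockMatrix q ω).transpose = clockMatrix q ω from Matrix.diagonal_transpose _] at h
  rw [h, inv_smul_smul₀ h0]

theorem clockMatrix_mul_inv (q : ℕ) {ω : ℂ} (h0 : ω ≠ 0) :
    clockMatrix q ω * clockMatrix q ω⁻¹ = 1 := by
  simp [clockMatrix, Matrix.diagonal_mul_diagonal, h0]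

theorem clockMatrix_inv_mul (q : ℕ) {ω : ℂ} (h0 : ω ≠ 0) :
    clockMatrix q ω⁻¹ * clockMatrix q ω = 1 :=
  mul_eq_one_comm.1 (clockMatrix_mul_inv q h0)

theorem cyclicShift_mul_transpose (q : ℕ) : cyclicShift q * (cyclicShift q).transpose = 1 := by
  ext i j
  simp [Matrix.mul_apply, cyclicShift_apply, Matrix.one_apply, -finRotate_apply, eq_comm]

/-- Conjugation by the clock matrix, via `S Z = ω Z S`. -/
theorem eval_weylPencil_shift_scale {q : ℕ} {ω : ℂ} (hω : ω ^ q = 1) (hq : q ≠ 0) (v : Fin 5 → ℂ) :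
    MvPolynomial.eval (fun s => (![ω, ω⁻¹, 1, 1, 1] : Fin 5 → ℂ) s * v s)
      (pencilDet (weylPencil q ω)) = MvPolynomial.eval v (pencilDet (weylPencil q ω)) := by
  have h0 : ω ≠ 0 := by rintro rfl; simp [hq] at hω
  rw [eval_pencilDet, eval_pencilDet]
  have h : (∑ s, v s • weylPencil q ω s) * clockMatrix q ω = clockMatrix q ω *
      ∑ s, ((![ω, ω⁻¹, 1, 1, 1] : Fin 5 → ℂ) s * v s) • weylPencil q ω s := by
    rw [sum_weylPencil, sum_weylPencil]
    simp only [add_mul, mul_add, Matrix.smul_mul, Matrix.mul_smul, cyclicShift_mul_clockMatrix hω,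
      transpose_cyclicShift_mul_clockMatrix hω h0, clockMatrix_inv_mul q h0,
      clockMatrix_mul_inv q h0, Matrix.cons_val, one_mul, mul_one, smul_smul, mul_comm]
  have hdet := congrArg Matrix.det h
  rw [Matrix.det_mul, Matrix.det_mul, mul_comm] at hdet
  refine (mul_left_cancel₀ ?_ hdet).symm
  refine left_ne_zero_of_mul (b := (clockMatrix q ω⁻¹).det) ?_
  rw [← Matrix.det_mul, clockMatrix_mul_inv q h0, Matrix.det_one]
  exact one_ne_zero

/-- The two symmetries give congruences modulo `q`. Since the total degree is also `q`, an
unbalanced pair must use up the whole degree in one variable. -/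
theorem balanced_of_coeff_weylPencil_ne_zero {q : ℕ} {ω : ℂ} (hω : IsPrimitiveRoot ω q)
    (hq : q ≠ 0) {m : Fin 5 →₀ ℕ} (hm : MvPolynomial.coeff m (pencilDet (weylPencil q ω)) ≠ 0) :
    (m 0 = m 1 ∧ m 2 = m 3) ∨ ∃ s : Fin 5, s ≠ 4 ∧ m = Finsupp.single s q := by
  have hd : m 0 + m 1 + m 2 + m 3 + m 4 = q := by
    have := isHomogeneous_pencilDet (weylPencil q ω) hm
    simpa [Finsupp.weight_apply, Finsupp.sum_fintype, Fin.sum_univ_five] using this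
  have dvd {a b : ℕ} (h : ω ^ a * (ω ^ b)⁻¹ = 1) : (q : ℤ) ∣ a - b := by
    rw [← hω.zpow_eq_one_iff_dvd, zpow_sub₀ (hω.ne_zero hq)]
    simpa [div_eq_mul_inv] using h
  have h1 : (q : ℤ) ∣ m 0 - m 1 := dvd (by
    simpa [Fin.prod_univ_five] using MvPolynomial.prod_pow_eq_one_of_eval_eq _ _
      (eval_weylPencil_shift_scale hω.pow_eq_one hq) hm)
  have h2 : (q : ℤ) ∣ m 2 - m 3 := dvd (by
    simpa [Fin.prod_univ_five] using MvPolynomial.prod_pow_eq_one_of_eval_eq _ _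
      (eval_weylPencil_clock_scale hω.pow_eq_one) hm)
  have tri {a b : ℕ} (h : (q : ℤ) ∣ a - b) (hab : a + b ≤ q) :
      a = b ∨ (a = q ∧ b = 0) ∨ (b = q ∧ a = 0) := by
    obtain ⟨c, hc⟩ := h
    have hq' : (0 : ℤ) < q := by positivity
    have c1 : c ≤ 1 := by by_contra! h; nlinarith
    have c2 : -1 ≤ c := by by_contra! h; nlinarith
    interval_cases c <;> omega
  have ext5 (s : Fin 5) (h : ∀ t, m t = if s = t then q else 0) : m = Finsupp.single s q := by
    ext t; rw [h, Finsupp.single_apply]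
  rcases tri h1 (by omega) with h1 | h1 | h1
  · rcases tri h2 (by omega) with h2 | h2 | h2
    · exact Or.inl ⟨h1, h2⟩
    · exact Or.inr ⟨2, by decide, ext5 _ fun t => by fin_cases t <;> simp <;> omega⟩
    · exact Or.inr ⟨3, by decide, ext5 _ fun t => by fin_cases t <;> simp <;> omega⟩
  · exact Or.inr ⟨0, by decide, ext5 _ fun t => by fin_cases t <;> simp <;> omega⟩
  · exact Or.inr ⟨1, by decide, ext5 _ fun t => by fin_cases t <;> simp <;> omega⟩

/-- Using a square root `η` of `ω` avoids the half-integral exponent `q (q - 1) / 2`. -/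
theorem prod_pow_val (q : ℕ) (η : ℂ) : ∏ i : Fin q, (η ^ 2) ^ (i : ℕ) = (η ^ q) ^ (q - 1) := by
  rw [Fin.prod_univ_eq_prod_range (fun i => (η ^ 2) ^ i), Finset.prod_pow_eq_pow_sum,
    ← pow_mul, ← pow_mul, mul_comm 2, Finset.sum_range_id_mul_two]

/-- The determinant of the Weyl pencil depends on the scalars `x`, `y` only through
`x ^ q + x⁻¹ ^ q + y ^ q + y⁻¹ ^ q`. -/
theorem exists_det_weylPencil_eq {q : ℕ} {η : ℂ} (hη : IsPrimitiveRoot (η ^ 2) q) (hq : q ≠ 0)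
    (hs : (η ^ q) ^ (q - 1) = (-1) ^ (q - 1)) (e : ℂ) :
    ∃ T : ℂ, ∀ x y : ℂ, x ≠ 0 → y ≠ 0 →
      (x • cyclicShift q + x⁻¹ • (cyclicShift q).transpose + y • clockMatrix q (η ^ 2) +
        y⁻¹ • clockMatrix q (η ^ 2)⁻¹ + e • 1).det =
      T + (-1) ^ (q - 1) * (x ^ q + x⁻¹ ^ q + y ^ q + y⁻¹ ^ q) := by
  classical
  set ω := η ^ 2 with hω
  set P := pencilDet (weylPencil q ω)
  have hP : P.IsHomogeneous q := by simpa using isHomogeneous_pencilDet (weylPencil q ω)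
  have hη' : (η⁻¹ ^ q) ^ (q - 1) = (-1) ^ (q - 1) := by
    rw [inv_pow, inv_pow, hs, ← inv_pow]; norm_num
  have hcoeff : ∀ s : Fin 5, s ≠ 4 → MvPolynomial.coeff (Finsupp.single s q) P = (-1) ^ (q - 1) := by
    intro s hs4
    rw [hP.coeff_single_eq_eval, eval_pencilDet, Finset.sum_eq_single s (by
      intro t _ h; simp [h]) (by simp), Pi.single_eq_same, one_smul]
    fin_cases s
    · exact det_cyclicShift q
    · exact (Matrix.det_transpose _).trans (det_cyclicShift q)
    · change (clockMatrix q (η ^ 2)).det = _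
      rw [clockMatrix, Matrix.det_diagonal, prod_pow_val, hs]
    · change (clockMatrix q (η ^ 2)⁻¹).det = _
      rw [clockMatrix, Matrix.det_diagonal, ← inv_pow, prod_pow_val, hη']
    · exact absurd rfl hs4
  -- On balanced monomials `x` cancels `x⁻¹` and `y` cancels `y⁻¹`, so only powers of `e` remain.
  let B : Finset (Fin 5 →₀ ℕ) := P.support.filter fun m => m 0 = m 1 ∧ m 2 = m 3
  refine ⟨∑ m ∈ B, P.coeff m * e ^ m 4, fun x y hx hy => ?_⟩
  have h := eval_pencilDet (weylPencil q ω) ![x, x⁻¹, y, y⁻¹, e]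
  rw [sum_weylPencil] at h
  simp only [Matrix.cons_val] at h
  rw [← h, MvPolynomial.eval_eq']
  rw [← Finset.sum_filter_add_sum_filter_not _ fun m : Fin 5 →₀ ℕ => m 0 = m 1 ∧ m 2 = m 3]
  congr 1
  · refine Finset.sum_congr rfl fun m hm => ?_
    obtain ⟨_, h0, h1⟩ := Finset.mem_filter.1 hm
    simp [P, Fin.prod_univ_five, h0, h1, hx, hy]
  · have hset : P.support.filter (fun m => ¬ (m 0 = m 1 ∧ m 2 = m 3)) =
        (Finset.univ.erase (4 : Fin 5)).image fun s => Finsupp.single s q := by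
      ext m
      simp only [Finset.mem_filter, MvPolynomial.mem_support_iff, Finset.mem_image,
        Finset.mem_erase, Finset.mem_univ, and_true]
      constructor
      · rintro ⟨h1, h2⟩
        rcases balanced_of_coeff_weylPencil_ne_zero hη hq h1 with h | ⟨s, hs, h⟩
        · exact absurd h h2
        · exact ⟨s, hs, h.symm⟩
      · rintro ⟨s, hs, rfl⟩
        refine ⟨by rw [hcoeff s hs]; simp, ?_⟩
        fin_cases s <;> simp_all [Ne.symm hq]
    rw [hset, Finset.sum_image (by
      intro s _ t _ hst
      exact (Finsupp.single_left_inj hq).1 hst)]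
    rw [Finset.sum_congr rfl fun s hs => by rw [hcoeff s (Finset.mem_erase.1 hs).1], ← Finset.mul_sum]
    congr 1
    have : (Finset.univ.erase (4 : Fin 5)) = {0, 1, 2, 3} := by decide
    rw [this]
    simp [Fin.prod_univ_five]
    ring

/-! ### Gaussian conjugation to the chiral gauge -/

/-- The circulant matrix with the Gaussian entries `η ^ (-(n (n - q)))`, `n = i - j`. -/
noncomputable def gaussCirculant (q : ℕ) (η : ℂ) : Matrix (Fin q) (Fin q) ℂ :=
  Matrix.of fun i j => η ^ (-((((i : ℕ) : ℤ) - (j : ℕ)) * (((i : ℕ) : ℤ) - (j : ℕ) - q)))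

/-- The linear term `- q` in the exponent compensates the `q ^ 2` produced by the shift; what is
left is a multiple of `2 q`. -/
theorem periodic_gauss {q : ℕ} {η : ℂ} (h0 : η ≠ 0) (hη : (η ^ 2) ^ q = 1) :
    Function.Periodic (fun n : ℤ => η ^ (-(n * (n - q)))) (q : ℤ) := by
  intro n
  have h1 : η ^ ((2 * q : ℕ) : ℤ) = 1 := by rw [zpow_natCast, pow_mul, hη]
  have : -((n + q) * (n + q - q)) = -(n * (n - q)) + ((2 * q : ℕ) : ℤ) * (-n) := by push_cast; ring
  change η ^ (-((n + q) * (n + q - q))) = _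
  rw [this, zpow_add₀ h0, zpow_mul, h1, one_zpow, mul_one]

theorem gaussCirculant_finRotate_left {q : ℕ} {η : ℂ} (h0 : η ≠ 0) (hη : (η ^ 2) ^ q = 1)
    (i j : Fin q) : gaussCirculant q η (finRotate q i) j =
      η ^ (-((((i : ℕ) : ℤ) + 1 - (j : ℕ)) * (((i : ℕ) : ℤ) + 1 - (j : ℕ) - q))) := by
  have := (periodic_gauss h0 hη).apply_val_finRotate i (-((j : ℕ) : ℤ))
  simp only [← sub_eq_add_neg] at this
  exact this

theorem gaussCirculant_finRotate_finRotate {q : ℕ} {η : ℂ} (h0 : η ≠ 0) (hη : (η ^ 2) ^ q = 1)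
    (i j : Fin q) :
    gaussCirculant q η (finRotate q i) (finRotate q j) = gaussCirculant q η i j := by
  have hp : Function.Periodic (fun n : ℤ => η ^ (-((((i : ℕ) : ℤ) + 1 - n) *
      (((i : ℕ) : ℤ) + 1 - n - q)))) (q : ℤ) := by
    intro n
    have := (periodic_gauss h0 hη).sub_eq ((i : ℕ) + 1 - n)
    simpa only [sub_sub] using this
  rw [gaussCirculant_finRotate_left h0 hη]
  have := hp.apply_val_finRotate j 0
  simp only [add_zero] at this
  rw [this, add_sub_add_right_eq_sub]
  rfl

theorem cyclicShift_mul_apply {q : ℕ} (M : Matrix (Fin q) (Fin q) ℂ) (i j : Fin q) :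
    (cyclicShift q * M) i j = M (finRotate q i) j := by
  simp [Matrix.mul_apply, cyclicShift_apply, -finRotate_apply]

theorem mul_cyclicShift_apply_finRotate {q : ℕ} (M : Matrix (Fin q) (Fin q) ℂ) (i j : Fin q) :
    (M * cyclicShift q) i (finRotate q j) = M i j := by
  simp [Matrix.mul_apply, cyclicShift_apply, -finRotate_apply]

theorem commute_cyclicShift_gaussCirculant {q : ℕ} {η : ℂ} (h0 : η ≠ 0) (hη : (η ^ 2) ^ q = 1) :
    cyclicShift q * gaussCirculant q η = gaussCirculant q η * cyclicShift q := by
  ext i j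
  obtain ⟨k, rfl⟩ := (finRotate q).surjective j
  rw [cyclicShift_mul_apply, mul_cyclicShift_apply_finRotate,
    gaussCirculant_finRotate_finRotate h0 hη]

theorem commute_transpose_cyclicShift_gaussCirculant {q : ℕ} {η : ℂ} (h0 : η ≠ 0)
    (hη : (η ^ 2) ^ q = 1) : (cyclicShift q).transpose * gaussCirculant q η =
      gaussCirculant q η * (cyclicShift q).transpose := by
  have h1 := cyclicShift_mul_transpose q
  have h2 := mul_eq_one_comm.1 h1
  calc (cyclicShift q).transpose * gaussCirculant q η
      = (cyclicShift q).transpose * (gaussCirculant q η * cyclicShift q) *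
          (cyclicShift q).transpose := by
        rw [mul_assoc, mul_assoc, h1, mul_one]
    _ = _ := by
        rw [← commute_cyclicShift_gaussCirculant h0 hη, ← mul_assoc, h2, one_mul]

/-- Completing the square: `(n + 1) (n + 1 - q) - n (n - q) = 2 n + 1 - q` with `n = i - j` trades
`ω ^ i` for `ω ^ j`. -/
theorem gaussCirculant_mul_clockMatrix {q : ℕ} {η : ℂ} (h0 : η ≠ 0) (hη : (η ^ 2) ^ q = 1) :
    η ^ (1 - q : ℤ) • (clockMatrix q (η ^ 2) * cyclicShift q * gaussCirculant q η) =
      gaussCirculant q η * clockMatrix q (η ^ 2) := by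
  ext i j
  rw [Matrix.smul_apply, mul_assoc, clockMatrix, Matrix.diagonal_mul, Matrix.mul_diagonal,
    cyclicShift_mul_apply, gaussCirculant_finRotate_left h0 hη, gaussCirculant, Matrix.of_apply,
    smul_eq_mul, ← pow_mul, ← pow_mul, ← zpow_natCast, ← zpow_natCast, ← zpow_add₀ h0,
    ← zpow_add₀ h0, ← zpow_add₀ h0]
  congr 1
  push_cast
  ring

theorem gaussCirculant_mul_clockMatrix_inv {q : ℕ} {η : ℂ} (h0 : η ≠ 0) (hη : (η ^ 2) ^ q = 1) :
    (η ^ (1 - q : ℤ))⁻¹ •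
        ((cyclicShift q).transpose * clockMatrix q (η ^ 2)⁻¹ * gaussCirculant q η) =
      gaussCirculant q η * clockMatrix q (η ^ 2)⁻¹ := by
  have h := gaussCirculant_mul_clockMatrix h0 hη
  have hc : η ^ (1 - q : ℤ) ≠ 0 := zpow_ne_zero _ h0
  have hω : η ^ 2 ≠ 0 := pow_ne_zero _ h0
  have h1 : (cyclicShift q).transpose * cyclicShift q = 1 :=
    mul_eq_one_comm.1 (cyclicShift_mul_transpose q)
  rw [inv_smul_eq_iff₀ hc]
  calc _ = (cyclicShift q).transpose * clockMatrix q (η ^ 2)⁻¹ *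
        (gaussCirculant q η * clockMatrix q (η ^ 2)) * clockMatrix q (η ^ 2)⁻¹ := by
        simp only [mul_assoc, clockMatrix_mul_inv q hω, mul_one]
    _ = _ := by
        rw [← h, Matrix.mul_smul, Matrix.smul_mul]
        congr 2
        calc _ = (cyclicShift q).transpose * (clockMatrix q (η ^ 2)⁻¹ * clockMatrix q (η ^ 2)) *
              cyclicShift q * gaussCirculant q η := by simp only [mul_assoc]
          _ = _ := by rw [clockMatrix_inv_mul q hω, mul_one, h1, one_mul]

/-- The transposed entrywise inverse is an inverse up to the factor `q`: off the diagonal the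
Gaussian phases reduce to a full sum of a nontrivial character. -/
theorem det_gaussCirculant_ne_zero {q : ℕ} {η : ℂ} (h0 : η ≠ 0) (hη : IsPrimitiveRoot (η ^ 2) q)
    (hq : q ≠ 0) : (gaussCirculant q η).det ≠ 0 := by
  let Q : Matrix (Fin q) (Fin q) ℂ := Matrix.of fun j i => (gaussCirculant q η i j)⁻¹
  have hPQ : gaussCirculant q η * Q = (q : ℂ) • 1 := by
    ext i i'
    rw [Matrix.mul_apply, Matrix.smul_apply, Matrix.one_apply]
    split_ifs with h
    · subst h
      simp [Q, gaussCirculant, zpow_ne_zero, h0]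
    · rw [smul_zero]
      set m : ℤ := (i' : ℕ) - (i : ℕ) with hm
      have hterm : ∀ j : Fin q, gaussCirculant q η i j * Q j i' =
          η ^ (m * m - m * q + 2 * (i : ℕ) * m) * ((η ^ 2) ^ (-m)) ^ (j : ℕ) := by
        intro j
        simp only [Q, gaussCirculant, Matrix.of_apply]
        rw [← zpow_neg, ← zpow_add₀ h0, ← zpow_natCast η 2, ← zpow_natCast (_ ^ (-m)), ← zpow_mul,
          ← zpow_mul, ← zpow_add₀ h0]
        congr 1
        rw [hm]; push_cast; ring
      rw [Finset.sum_congr rfl fun j _ => hterm j, ← Finset.mul_sum,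
        Fin.sum_univ_eq_sum_range (fun j => ((η ^ 2) ^ (-m)) ^ j)]
      have hne : (η ^ 2) ^ (-m) - 1 ≠ 0 := by
        rw [sub_ne_zero, Ne, hη.zpow_eq_one_iff_dvd]
        intro hd
        have h1 := i.isLt
        have h2 := i'.isLt
        have h3 := Int.eq_zero_of_abs_lt_dvd hd (by rw [abs_lt]; omega)
        exact h (Fin.ext (by omega))
      have hz : ((η ^ 2) ^ (-m) - 1) * ∑ j ∈ Finset.range q, ((η ^ 2) ^ (-m)) ^ j = 0 := by
        rw [mul_comm, geom_sum_mul, ← zpow_natCast, zpow_comm, zpow_natCast, hη.pow_eq_one, one_zpow,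
          sub_self]
      rw [(mul_eq_zero.1 hz).resolve_left hne, mul_zero]
  have hdet := congrArg Matrix.det hPQ
  rw [Matrix.det_mul, Matrix.det_smul, Matrix.det_one, mul_one] at hdet
  refine left_ne_zero_of_mul (b := Q.det) ?_
  rw [hdet]
  exact pow_ne_zero _ (Nat.cast_ne_zero.2 hq)

theorem det_weylPencil_eq_det_chiral {q : ℕ} {η : ℂ} (h0 : η ≠ 0)
    (hη : IsPrimitiveRoot (η ^ 2) q) (hq : q ≠ 0) (x y e : ℂ) :
    (x • cyclicShift q + x⁻¹ • (cyclicShift q).transpose + y • clockMatrix q (η ^ 2) +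
        y⁻¹ • clockMatrix q (η ^ 2)⁻¹ + e • 1).det =
      (x • cyclicShift q + x⁻¹ • (cyclicShift q).transpose +
        (y * η ^ (1 - q : ℤ)) • (clockMatrix q (η ^ 2) * cyclicShift q) +
        (y * η ^ (1 - q : ℤ))⁻¹ • ((cyclicShift q).transpose * clockMatrix q (η ^ 2)⁻¹) +
        e • 1).det := by
  refine mul_left_cancel₀ (det_gaussCirculant_ne_zero h0 hη hq) ?_
  conv_rhs => rw [mul_comm]
  rw [← Matrix.det_mul, ← Matrix.det_mul]
  congr 1
  simp only [add_mul, mul_add, Matrix.smul_mul, Matrix.mul_smul, one_mul, mul_one,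
    commute_cyclicShift_gaussCirculant h0 hη.pow_eq_one,
    commute_transpose_cyclicShift_gaussCirculant h0 hη.pow_eq_one,
    ← gaussCirculant_mul_clockMatrix h0 hη.pow_eq_one,
    ← gaussCirculant_mul_clockMatrix_inv h0 hη.pow_eq_one, smul_smul, mul_inv]

/-! ### Tridiagonal determinants and the cut ring -/

/-- The tridiagonal `n × n` matrix with constant diagonal `e`, superdiagonal `f` and subdiagonal `g`. -/
def tridiagonal (n : ℕ) (f g : ℕ → ℂ) (e : ℂ) : Matrix (Fin n) (Fin n) ℂ :=
  Matrix.of fun i j => (if (i : ℕ) + 1 = j then f i else 0) + (if (j : ℕ) + 1 = i then g j else 0) +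
    if (i : ℕ) = j then e else 0

theorem det_weylPencil_eq_det_tridiagonal {q : ℕ} {η : ℂ} (hη : IsPrimitiveRoot (η ^ 2) q)
    (hq : q ≠ 0) (hs : (η ^ q) ^ (q - 1) = (-1) ^ (q - 1)) {x y : ℂ} (hx : x ≠ 0) (hy : y ≠ 0)
    (e : ℂ) :
    (x • cyclicShift q + x⁻¹ • (cyclicShift q).transpose + y • clockMatrix q (η ^ 2) +
        y⁻¹ • clockMatrix q (η ^ 2)⁻¹ + e • 1).det =
      (tridiagonal q (fun i => 1 - (η ^ 2) ^ (i + 1)) (fun i => 1 - (η ^ 2)⁻¹ ^ (i + 1)) e).det +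
        (-1) ^ (q - 1) * (x ^ q + x⁻¹ ^ q + y ^ q + y⁻¹ ^ q) := by
  have hω : (η ^ 2) ^ q = 1 := hη.pow_eq_one
  have hω' : (η ^ 2)⁻¹ ^ q = 1 := by rw [inv_pow, hω, inv_one]
  have h0 : η ≠ 0 := by rintro rfl; simp [hq] at hω
  obtain ⟨T, hT⟩ := exists_det_weylPencil_eq hη hq hs e
  rw [hT x y hx hy]
  congr 1
  -- With `x = 1`, this `y` makes the coefficient `y * η ^ (1 - q)` equal to `-1`, so the bond at `i
  -- = 0` is `1 - 1 = 0`; also `y ^ q = -1`, so the pure powers sum to `1 + 1 - 1 - 1 = 0`.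
  have hy1 : (-η ^ (q - 1)) ^ q = -1 := by
    obtain ⟨n, rfl⟩ := Nat.exists_eq_succ_of_ne_zero hq
    simp only [Nat.succ_eq_add_one, Nat.add_sub_cancel] at hs ⊢
    rw [neg_pow, pow_right_comm, hs, ← pow_add]
    exact Odd.neg_one_pow ⟨n, by omega⟩
  have h1 := hT 1 (-η ^ (q - 1)) one_ne_zero (neg_ne_zero.2 (pow_ne_zero _ h0))
  have hc : -η ^ (q - 1) * η ^ (1 - q : ℤ) = -1 := by
    rw [← zpow_natCast, Nat.cast_sub (Nat.one_le_iff_ne_zero.2 hq), neg_mul, ← zpow_add₀ h0]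
    simp
  rw [det_weylPencil_eq_det_chiral h0 hη hq, hc, inv_pow (-_), hy1] at h1
  have h2 : T + (-1) ^ (q - 1) * (1 ^ q + 1⁻¹ ^ q + -1 + (-1)⁻¹) = T := by norm_num
  -- Relabelling by one step moves the vanishing bond to the corners.
  rw [← h2, ← h1, ← Matrix.det_submatrix_equiv_self (finRotate q)]
  congr 1
  ext i j
  have hl (ω : ℂ) (i j : Fin q) : (if finRotate q i = j then 1 - ω ^ (j : ℕ) else 0) =
      if (i : ℕ) + 1 = j then 1 - ω ^ ((i : ℕ) + 1) else 0 := by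
    rcases val_finRotate_cases i with ⟨h, h'⟩ | ⟨h, h'⟩
    · simp only [Fin.ext_iff, h]
      split_ifs with h3
      · rw [h3]
      · rfl
    · simp only [Fin.ext_iff, h]
      have := j.isLt
      rw [if_neg (by omega : ¬ (i : ℕ) + 1 = j)]
      split_ifs with h3
      · rw [← h3]; simp
      · rfl
  have hS : cyclicShift q (finRotate q i) (finRotate q j) = if finRotate q i = j then 1 else 0 := by
    simp only [cyclicShift_apply, (finRotate q).injective.eq_iff]
  have hS' : cyclicShift q (finRotate q j) (finRotate q i) = if finRotate q j = i then 1 else 0 := by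
    simp only [cyclicShift_apply, (finRotate q).injective.eq_iff]
  have h3 := hl (η ^ 2) i j
  have h4 := hl (η ^ 2)⁻¹ j i
  simp only [tridiagonal, Matrix.of_apply]
  rw [← h3, ← h4]
  simp only [Matrix.submatrix_apply, Matrix.add_apply, Matrix.smul_apply, clockMatrix,
    Matrix.diagonal_mul, Matrix.mul_diagonal, Matrix.transpose_apply, hS, hS', Matrix.one_apply,
    (finRotate q).injective.eq_iff, smul_eq_mul, Fin.ext_iff (a := i)]
  by_cases h5 : finRotate q i = j <;> by_cases h6 : finRotate q j = i <;>
    simp only [h5, h6, if_true, if_false] <;> norm_num <;> ring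

theorem det_tridiagonal_succ_succ (n : ℕ) (f g : ℕ → ℂ) (e : ℂ) :
    (tridiagonal (n + 2) f g e).det =
      e * (tridiagonal (n + 1) (fun i => f (i + 1)) (fun i => g (i + 1)) e).det -
        f 0 * g 0 * (tridiagonal n (fun i => f (i + 2)) (fun i => g (i + 2)) e).det := by
  rw [Matrix.det_succ_row_zero, Fin.sum_univ_succ, Fin.sum_univ_succ, Finset.sum_eq_zero]
  · have h0 : tridiagonal (n + 2) f g e 0 0 = e := by simp [tridiagonal]
    have h1 : tridiagonal (n + 2) f g e 0 (Fin.succ 0) = f 0 := by simp [tridiagonal]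
    have hA : (tridiagonal (n + 2) f g e).submatrix Fin.succ (Fin.succAbove 0) =
        tridiagonal (n + 1) (fun i => f (i + 1)) (fun i => g (i + 1)) e := by
      ext i j
      simp [tridiagonal]
    have hB : ((tridiagonal (n + 2) f g e).submatrix Fin.succ (Fin.succAbove (Fin.succ 0))).det =
        g 0 * (tridiagonal n (fun i => f (i + 2)) (fun i => g (i + 2)) e).det := by
      rw [Matrix.det_succ_column_zero, Fin.sum_univ_succ, Finset.sum_eq_zero]
      · rw [add_zero]
        congr 1
        · simp [tridiagonal]
        · congr 1
          ext i j
          simp [tridiagonal]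
      · intro i _
        simp [tridiagonal]
    rw [h0, h1, hA, hB]
    simp
    ring
  · intro i _
    simp [tridiagonal]

/-- The three-term recurrence involves the off-diagonal entries only through `f i * g i`. -/
theorem det_tridiagonal_congr (n : ℕ) {f g f' g' : ℕ → ℂ} (e : ℂ)
    (h : ∀ i, i + 1 < n → f i * g i = f' i * g' i) :
    (tridiagonal n f g e).det = (tridiagonal n f' g' e).det := by
  induction n using Nat.strong_induction_on generalizing f g f' g' with
  | _ n ih =>
    match n with
    | 0 => simp
    | 1 => simp [tridiagonal]
    | n + 2 =>
      rw [det_tridiagonal_succ_succ, det_tridiagonal_succ_succ, h 0 (by omega),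
        ih (n + 1) (by omega) (fun i hi => h (i + 1) (by omega)),
        ih n (by omega) (fun i hi => h (i + 2) (by omega))]

theorem det_tridiagonal_add {m : ℕ} (n : ℕ) {f g : ℕ → ℂ} (e : ℂ)
    (hf : f m = 0) (hg : g m = 0) :
    (tridiagonal (m + 1 + n) f g e).det = (tridiagonal (m + 1) f g e).det *
      (tridiagonal n (fun i => f (m + 1 + i)) (fun i => g (m + 1 + i)) e).det := by
  rw [← Matrix.det_submatrix_equiv_self finSumFinEquiv, ← Matrix.det_fromBlocks_zero₁₂ _ 0]
  congr 1
  ext i j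
  rcases i with i | i <;> rcases j with j | j
  · simp [tridiagonal]
  · have := i.isLt
    simp [tridiagonal]
    grind
  · have := j.isLt
    simp [tridiagonal]
    grind
  · simp [tridiagonal, add_assoc]

/-! ### The Harper matrix and its discriminant -/

theorem det_harperMatrix_eq_det_weylPencil {p q : ℕ} (hq : 3 ≤ q) (θ k : ℝ) (ℓ : ℤ) (E : ℂ)
    {x y ω : ℂ} (hx : x = Complex.exp (Complex.I * k))
    (hy : y = Complex.exp (2 * Real.pi * Complex.I * (p / q * ℓ + θ)))
    (hω : ω = Complex.exp (2 * Real.pi * Complex.I * (p / q))) :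
    (harperMatrix p q θ k ℓ - E • (1 : Matrix (Fin q) (Fin q) ℂ)).det =
      (x • cyclicShift q + x⁻¹ • (cyclicShift q).transpose + y • clockMatrix q ω +
        y⁻¹ • clockMatrix q ω⁻¹ + (-E) • 1).det := by
  have hx0 : x ≠ 0 := hx ▸ Complex.exp_ne_zero _
  have hxq : Complex.exp (Complex.I * k * q) = x ^ q := by
    rw [hx, ← Complex.exp_nat_mul]; congr 1; ring
  have hcoeff (i : ℕ) : (harperCoeff p q θ (ℓ + (i : ℤ)) : ℂ) = y * ω ^ i + y⁻¹ * ω⁻¹ ^ i := by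
    rw [hy, hω, ← Complex.exp_neg, ← Complex.exp_neg, ← Complex.exp_nat_mul, ← Complex.exp_nat_mul,
      ← Complex.exp_add, ← Complex.exp_add, harperCoeff, Complex.ofReal_mul, Complex.ofReal_cos,
      Complex.cos]
    push_cast
    rw [mul_div_cancel₀ _ two_ne_zero]
    congr 2 <;> ring
  -- Conjugation by `diag (x ^ i)` spreads the Bloch phase from the corners evenly over all bonds.
  have hdet : (clockMatrix q x).det ≠ 0 := by
    refine left_ne_zero_of_mul (b := (clockMatrix q x⁻¹).det) ?_
    rw [← Matrix.det_mul, clockMatrix_mul_inv q hx0, Matrix.det_one]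
    exact one_ne_zero
  refine mul_left_cancel₀ hdet ?_
  rw [mul_comm, ← Matrix.det_mul, ← Matrix.det_mul]
  congr 1
  ext i j
  rw [clockMatrix, Matrix.mul_diagonal, Matrix.diagonal_mul]
  have hi := i.isLt
  have hj := j.isLt
  have hS (i j : Fin q) : cyclicShift q i j =
      if (i : ℕ) + 1 = j ∨ ((i : ℕ) + 1 = q ∧ (j : ℕ) = 0) then 1 else 0 := by
    rw [cyclicShift_apply]
    refine if_congr ?_ rfl rfl
    rw [Fin.ext_iff]
    have := j.isLt
    rcases val_finRotate_cases i with ⟨h, h'⟩ | ⟨h, h'⟩ <;> rw [h] <;> omega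
  simp only [Matrix.sub_apply, Matrix.add_apply, Matrix.smul_apply, Matrix.transpose_apply, hS,
    harperMatrix, Matrix.of_apply, clockMatrix, Matrix.diagonal_apply, Matrix.one_apply,
    Complex.exp_neg, hxq, hcoeff, smul_eq_mul]
  by_cases h1 : i = j
  · subst h1
    have e1 : ¬ ((i : ℕ) + 1 = i ∨ (i : ℕ) + 1 = q ∧ (i : ℕ) = 0) := by omega
    simp only [if_true, e1, if_false]
    ring
  · have h1' : (i : ℕ) ≠ j := fun h => h1 (Fin.ext h)
    simp only [h1, if_false]
    by_cases h2 : (i : ℕ) + 1 = j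
    · have e1 : ¬ ((j : ℕ) + 1 = i ∨ (j : ℕ) + 1 = q ∧ (i : ℕ) = 0) := by omega
      simp only [h2, e1, true_or, if_true, if_false]
      rw [← h2]; ring
    · by_cases h3 : (j : ℕ) + 1 = i
      · have e1 : ¬ ((i : ℕ) + 1 = j ∨ (i : ℕ) + 1 = q ∧ (j : ℕ) = 0) := by omega
        rw [if_neg h2, if_pos h3, if_neg e1, if_pos (Or.inl h3), ← h3, pow_succ]
        field_simp
        ring
      · by_cases h4 : (i : ℕ) = 0 ∧ (j : ℕ) + 1 = q
        · have e1 : ¬ ((i : ℕ) + 1 = j ∨ (i : ℕ) + 1 = q ∧ (j : ℕ) = 0) := by omega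
          have e2 : x ^ q = x ^ (j : ℕ) * x := by rw [← pow_succ, h4.2]
          rw [if_neg h2, if_neg h3, if_pos h4, if_neg e1, if_pos (Or.inr ⟨h4.2, h4.1⟩), h4.1, e2]
          field_simp
          simp
        · by_cases h5 : (i : ℕ) + 1 = q ∧ (j : ℕ) = 0
          · have e1 : ¬ ((j : ℕ) + 1 = i ∨ (j : ℕ) + 1 = q ∧ (i : ℕ) = 0) := by omega
            have e2 : x ^ q = x ^ (i : ℕ) * x := by rw [← pow_succ, h5.1]
            rw [if_neg h2, if_neg h3, if_neg h4, if_pos h5, if_neg e1, if_pos (Or.inr h5), h5.2, e2]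
            ring
          · have e1 : ¬ ((j : ℕ) + 1 = q ∧ (i : ℕ) = 0) := by omega
            simp only [h2, h3, h4, h5, e1, or_self, if_false]
            ring

theorem exp_add_inv_exp (a : ℝ) :
    Complex.exp (Complex.I * a) + (Complex.exp (Complex.I * a))⁻¹ = 2 * (Real.cos a : ℝ) := by
  rw [Complex.ofReal_cos, Complex.two_cos, ← Complex.exp_neg]
  congr 2 <;> ring

/-- The tridiagonal determinant equal to the discriminant `Δ_{p/q}`, in terms of
`ω = exp (2πi p/q)`. -/
noncomputable def cutDet (q : ℕ) (ω E : ℂ) : ℂ :=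
  (tridiagonal q (fun i => 1 - ω ^ (i + 1)) (fun i => 1 - ω⁻¹ ^ (i + 1)) (-E)).det

theorem isChambersDiscriminant_cutDet {p q : ℕ} (hpq : p.Coprime q) (hq : 3 ≤ q) :
    IsChambersDiscriminant p q
      (cutDet q (Complex.exp (2 * Real.pi * Complex.I * (p / q)))) := by
  intro θ k ℓ E
  have hq0 : q ≠ 0 := by omega
  have hqC : (q : ℂ) ≠ 0 := Nat.cast_ne_zero.2 hq0
  set η : ℂ := Complex.exp (Real.pi * Complex.I * (p / q)) with hη
  have hω : η ^ 2 = Complex.exp (2 * Real.pi * Complex.I * (p / q)) := by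
    rw [hη, ← Complex.exp_nat_mul]; congr 1; push_cast; ring
  have hprim : IsPrimitiveRoot (η ^ 2) q := by
    rw [hω]; exact Complex.isPrimitiveRoot_exp_of_coprime p q hq0 hpq
  have hηq : η ^ q = (-1) ^ p := by
    rw [hη, ← Complex.exp_nat_mul, ← Complex.exp_pi_mul_I, ← Complex.exp_nat_mul]
    congr 1; field_simp
  have hs : (η ^ q) ^ (q - 1) = (-1) ^ (q - 1) := by
    rw [hηq, ← pow_mul]
    -- For even `q`, coprimality forces `p` odd; for odd `q`, both sides are `1`.
    rcases Nat.even_or_odd q with h | h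
    · have hp : Odd p := by
        rw [← Nat.not_even_iff_odd]
        intro h'
        have := Nat.dvd_gcd h'.two_dvd h.two_dvd
        rw [hpq.gcd_eq_one] at this
        omega
      rw [pow_mul, hp.neg_one_pow]
    · have : Even (q - 1) := by
        obtain ⟨m, rfl⟩ := h; simp
      rw [this.neg_one_pow, (this.mul_left p).neg_one_pow]
  rw [det_harperMatrix_eq_det_weylPencil hq θ k ℓ E rfl rfl hω,
    det_weylPencil_eq_det_tridiagonal hprim hq0 hs (Complex.exp_ne_zero _) (Complex.exp_ne_zero _),
    ← hω, cutDet]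
  have hx : Complex.exp (Complex.I * k) ^ q = Complex.exp (Complex.I * ((k * q : ℝ) : ℂ)) := by
    rw [← Complex.exp_nat_mul]; congr 1; push_cast; ring
  have hy : Complex.exp (2 * Real.pi * Complex.I * (p / q * ℓ + θ)) ^ q =
      Complex.exp (Complex.I * ((2 * Real.pi * q * θ : ℝ) : ℂ)) := by
    rw [← Complex.exp_nat_mul, Complex.exp_eq_exp_iff_exists_int]
    -- The offset `ℓ` contributes `p * ℓ` full turns, hence nothing.
    refine ⟨p * ℓ, ?_⟩
    push_cast
    field_simp
    ring
  have hsign : (-1 : ℂ) ^ q = -(-1) ^ (q - 1) := by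
    obtain ⟨m, rfl⟩ := Nat.exists_eq_succ_of_ne_zero hq0
    simp [pow_succ]
  rw [inv_pow, inv_pow, hx, hy, exp_add_inv_exp, add_assoc, exp_add_inv_exp, hsign]
  push_cast
  ring

theorem chambersDiscriminant_eq_of_isChambersDiscriminant {p q : ℕ} (hq : q ≠ 0) {Δ : ℂ → ℂ}
    (h : IsChambersDiscriminant p q Δ) : chambersDiscriminant p q = Δ := by
  funext E
  have hqR : (q : ℝ) ≠ 0 := Nat.cast_ne_zero.2 hq
  have h1 : 2 * Real.pi * q * (1 / (4 * (q : ℝ))) = Real.pi / 2 := by field_simp; norm_num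
  have h2 : Real.pi / (2 * (q : ℝ)) * q = Real.pi / 2 := by field_simp
  rw [chambersDiscriminant, h, h1, h2, Real.cos_pi_div_two]
  simp

/-! ### The chiral matrix at `θ = 0` -/

theorem sq_ofReal_two_mul_sin {φ : ℝ} {w : ℂ} (hw : w = Complex.exp (2 * Complex.I * φ)) :
    ((2 * Real.sin φ : ℝ) : ℂ) * ((2 * Real.sin φ : ℝ) : ℂ) = (1 - w) * (1 - w⁻¹) := by
  have h0 := Complex.exp_ne_zero (φ * Complex.I)
  have hw' : w = Complex.exp (φ * Complex.I) ^ 2 := by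
    rw [hw, ← Complex.exp_nat_mul]; congr 1; push_cast; ring
  rw [hw', Complex.ofReal_mul, Complex.ofReal_sin, Complex.sin, neg_mul, Complex.exp_neg]
  push_cast
  field_simp
  linear_combination (Complex.exp (φ * Complex.I) ^ 2 - 1) ^ 2 * Complex.I_sq

/-- Relabelling by one step puts `b_0 = 0` in the corners and the phased bond `b_{q-1}` last, where
its phases `c` and `c⁻¹` cancel in the product. -/
theorem chiralDiscriminant_eq_det_tridiagonal {p q : ℕ} (hq : 3 ≤ q) (E : ℂ) :
    chiralDiscriminant p q E = (tridiagonal q (fun i => (chiralCoeff p q 0 ((i + 1 : ℕ) : ℤ) : ℂ))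
      (fun i => (chiralCoeff p q 0 ((i + 1 : ℕ) : ℤ) : ℂ)) (-E)).det := by
  rw [chiralDiscriminant, chiralDetZero, chiralDet]
  set k : ℝ := Real.pi / (2 * (q : ℝ))
  set c : ℂ := Complex.exp (Complex.I * k * q) with hc
  have hc0 : c ≠ 0 := Complex.exp_ne_zero _
  set b : ℕ → ℂ := fun n => (chiralCoeff p q 0 (n : ℤ) : ℂ) with hb
  have hb0 : b 0 = 0 := by simp [hb, chiralCoeff]
  have hM (i j : Fin q) : chiralMatrix p q 0 k 0 i j =
      if (i : ℕ) + 1 = j then b i else if (j : ℕ) + 1 = i then b j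
      else if (i : ℕ) = 0 ∧ (j : ℕ) + 1 = q then c⁻¹ * b (q - 1)
      else if (i : ℕ) + 1 = q ∧ (j : ℕ) = 0 then c * b (q - 1) else 0 := by
    simp only [chiralMatrix, Matrix.of_apply, zero_add, Complex.exp_neg, hb, hc]
    rw [show (q : ℤ) - 1 = ((q - 1 : ℕ) : ℤ) by omega]
  rw [← Matrix.det_submatrix_equiv_self (finRotate q)]
  trans (tridiagonal q (fun i => b (i + 1) * if i + 2 = q then c else 1)
    (fun i => b (i + 1) * if i + 2 = q then c⁻¹ else 1) (-E)).det
  · congr 1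
    ext i j
    rw [Matrix.submatrix_apply, Matrix.sub_apply, Matrix.smul_apply, hM, Matrix.one_apply]
    simp only [(finRotate q).injective.eq_iff, tridiagonal, Matrix.of_apply, Fin.ext_iff (a := i),
      smul_eq_mul]
    clear_value b c
    clear hM hb hc
    have hi := i.isLt
    have hj := j.isLt
    rcases val_finRotate_cases i with ⟨h, h'⟩ | ⟨h, h'⟩ <;>
      rcases val_finRotate_cases j with ⟨g, g'⟩ | ⟨g, g'⟩ <;> rw [h, g]
    · grind
    · grind
    · grind
    · grind
  · refine det_tridiagonal_congr _ _ fun i _ => ?_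
    change _ = b (i + 1) * b (i + 1)
    split_ifs
    · field_simp
    · simp

theorem det_tridiagonal_chiralCoeff {p q r m : ℕ} (E : ℂ) {ω : ℂ}
    (hω : ω = Complex.exp (2 * Real.pi * Complex.I * (2 * p / q))) (hm : ω ^ m = 1) :
    (tridiagonal r (fun i => (chiralCoeff p q 0 ((m + i + 1 : ℕ) : ℤ) : ℂ))
      (fun i => (chiralCoeff p q 0 ((m + i + 1 : ℕ) : ℤ) : ℂ)) (-E)).det = cutDet r ω E := by
  rw [cutDet]
  refine det_tridiagonal_congr _ _ fun i _ => ?_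
  rw [inv_pow, chiralCoeff]
  refine sq_ofReal_two_mul_sin ?_
  rw [← one_mul (ω ^ (i + 1)), ← hm, ← pow_add, hω, ← Complex.exp_nat_mul]
  congr 1
  push_cast
  ring

theorem mainTheorem3 (p q : ℕ) (hp : 0 < p) (hq : 0 < q) (hpq : Nat.Coprime p q) :
    (Odd q → 3 ≤ q →
      IsChambersDiscriminant (2 * p) q (chambersDiscriminant (2 * p) q) ∧
        ∀ E : ℂ, chiralDiscriminant p q E = chambersDiscriminant (2 * p) q E) ∧
    (Even q → 3 ≤ q / 2 →
      IsChambersDiscriminant p (q / 2) (chambersDiscriminant p (q / 2)) ∧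
        ∀ E : ℂ, chiralDiscriminant p q E = chambersDiscriminant p (q / 2) E ^ 2) := by
  constructor
  · intro hodd h3
    have hcop : (2 * p).Coprime q := Nat.Coprime.mul_left hodd.coprime_two_left hpq
    have h := isChambersDiscriminant_cutDet hcop h3
    rw [chambersDiscriminant_eq_of_isChambersDiscriminant hq.ne' h]
    refine ⟨h, fun E => ?_⟩
    rw [chiralDiscriminant_eq_det_tridiagonal h3]
    simpa using det_tridiagonal_chiralCoeff (p := p) (r := q) (m := 0) E rfl (pow_zero _)
  · intro heven h3
    obtain ⟨r, rfl⟩ := heven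
    have hr : (r + r) / 2 = r := by omega
    rw [hr] at h3 ⊢
    have hr0 : r ≠ 0 := by omega
    have hcop : p.Coprime r := Nat.Coprime.coprime_dvd_right ⟨2, by ring⟩ hpq
    have h := isChambersDiscriminant_cutDet hcop h3
    rw [chambersDiscriminant_eq_of_isChambersDiscriminant hr0 h]
    refine ⟨h, fun E => ?_⟩
    rw [chiralDiscriminant_eq_det_tridiagonal (by omega)]
    obtain ⟨m, rfl⟩ := Nat.exists_eq_succ_of_ne_zero hr0
    have hω : Complex.exp (2 * Real.pi * Complex.I * (p / (m.succ : ℕ))) =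
        Complex.exp (2 * Real.pi * Complex.I * (2 * p / (m.succ + m.succ : ℕ))) := by
      congr 2
      have : (m.succ : ℂ) ≠ 0 := Nat.cast_ne_zero.2 hr0
      push_cast at this ⊢
      field_simp
      ring
    have hω1 := (Complex.isPrimitiveRoot_exp_of_coprime p m.succ hr0 hcop).pow_eq_one
    -- Here `m + 1 = q / 2`: the second zero of the sine, stored at index `m` because bond `i`
    -- carries `b_{i+1}`.
    have hcut : (chiralCoeff p (m.succ + m.succ) 0 ((m + 1 : ℕ) : ℤ) : ℂ) = 0 := by
      have : 2 * Real.pi * ((p : ℝ) / ((m.succ + m.succ : ℕ) : ℝ) * (((m + 1 : ℕ) : ℤ) : ℝ) + 0) =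
          p * Real.pi := by
        push_cast
        field_simp
        ring
      rw [chiralCoeff, this, Real.sin_nat_mul_pi]
      simp
    rw [show (m.succ + m.succ) = m + 1 + m.succ from rfl] at *
    rw [det_tridiagonal_add m.succ (-E) hcut hcut, sq]
    congr 1
    · simpa using det_tridiagonal_chiralCoeff (p := p) (r := m.succ) (m := 0) E hω (pow_zero _)
    -- The second block starts half a ring later, and `ω ^ (q / 2) = 1` makes its bond products
    -- equal to those of the first.
    · exact det_tridiagonal_chiralCoeff (p := p) (r := m.succ) (m := m.succ) E hω hω1
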